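/- Let $n\ge 1$, $m\ge 1$ and $k\ge 0$ be integers. Let $V=\{v\in\mathbb R^n \mid \sum_i v_i=0\}$ and let $\Delta^+=\{\varepsilon_i-\varepsilon_j \mid 1\le i<j\le n\}$ be the positive roots of type $A_{n-1}$. For $\alpha\in\Delta^+$ and $l\in\mathbb Z$ put $H_{\alpha,l}=\{v\in V\mid\langle v,\alpha\rangle=l\}$. The $m$-Shi arrangement consists of the hyperplanes $H_{\alpha,l}$ with $\alpha\in\Delta^+$ and $-m<l\le m$. A dominant region is a connected component of the complement of this arrangement in $V$ that lies in the dominant chamber $\{v\in V\mid v_1\ge v_2\ge\dots\ge v_n\}$. The fundamental alcove is $\mathcal A_0=\{v\in V\mid v_i>v_{i+1}\text{ for }1\le i<n,\ v_1-v_n<1\}$. The $m$-Narayana number $N^m(k)$ of type $A_{n-1}$ is the number of dominant regions $R$ for which there are exactly $k$ hyperplanes of the form $H_{\alpha,m}$, $\alpha\in\Delta^+$, that separate $R$ from $\mathcal A_0$ and contain a wall of $R$ (that is, $\overline R\cap H_{\alpha,m}$ affinely spans $H_{\alpha,m}$). A partition $\lambda$ is a $t$-core if none of its hook lengths is divisible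 by $t$. The box of $\lambda$ in row $x$ and column $y$ has residue $y-x \bmod n$, and a box is removable if removing it from the diagram of $\lambda$ leaves the diagram of a partition. Then $N^m(k)$ is finite and equals the (finite) number of partitions $\lambda$ such that $\lambda$ is both an $n$-core and an $(mn+1)$-core and there is a set $K\subseteq\mathbb Z/n\mathbb Z$ with $|K|=k$ such that, for every $i\in\mathbb Z/n\mathbb Z$, $\lambda$ has exactly $m$ removable boxes of residue $i$ if and only if $i\in K$. -/

import Mathlib

namespace ShiCore

/-! ### The root system of type `A_{n-1}` and the `m`-Shi arrangement -/

/-- The space `V = {(a₁, …, aₙ) ∈ ℝⁿ ∣ ∑ aᵢ = 0}` (coordinates are indexed from `0`), with the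
usual topology of a finite-dimensional real vector space. -/
def V (n : ℕ) : Submodule ℝ (Fin n → ℝ) where
  carrier := {v | ∑ i, v i = 0}
  add_mem' := by
    intro a b ha hb
    simp only [Set.mem_ofPred_eq] at ha hb ⊢
    simp [Finset.sum_add_distrib, ha, hb]
  zero_mem' := by simp
  smul_mem' := by
    intro c a ha
    simp only [Set.mem_ofPred_eq] at ha ⊢
    simp [← Finset.mul_sum, ha]

/-- The vector `ε_i - ε_j`. -/
def root {n : ℕ} (i j : Fin n) : Fin n → ℝ := Pi.single i 1 - Pi.single j 1

/-- The positive roots `ε_i - ε_j`, `i < j`. -/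
def positiveRoots (n : ℕ) : Set (Fin n → ℝ) := {α | ∃ i j : Fin n, i < j ∧ α = root i j}

/-- The simple roots `ε_i - ε_{i+1}`. -/
def simpleRoots (n : ℕ) : Set (Fin n → ℝ) :=
  {α | ∃ i j : Fin n, (i : ℕ) + 1 = (j : ℕ) ∧ α = root i j}

/-- The highest root `θ = ε_1 - ε_n`. -/
def highestRoot (n : ℕ) [NeZero n] : Fin n → ℝ := root 0 (Fin.rev 0)

/-- The standard bilinear form `⟨v, α⟩ = ∑ v_i α_i`. -/
def pairing {n : ℕ} (v : V n) (α : Fin n → ℝ) : ℝ := (v : Fin n → ℝ) ⬝ᵥ α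

/-- The affine hyperplane `H_{α,k} = {v ∈ V ∣ ⟨v, α⟩ = k}`. -/
def hyperplane {n : ℕ} (α : Fin n → ℝ) (k : ℤ) : Set (V n) := {v | pairing v α = k}

/-- The complement in `V` of the `m`-Shi arrangement
`{H_{α,k} ∣ α > 0, -m < k ≤ m}`. -/
def shiComplement (n m : ℕ) : Set (V n) :=
  {v | ∀ α ∈ positiveRoots n, ∀ k : ℤ, -(m : ℤ) < k → k ≤ m → v ∉ hyperplane α k}

/-- The (closed) dominant chamber. -/
def dominantChamber (n : ℕ) : Set (V n) := {v | ∀ α ∈ simpleRoots n, 0 ≤ pairing v α}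

/-- The (open) fundamental alcove `A_0`. -/
def fundamentalAlcove (n : ℕ) [NeZero n] : Set (V n) :=
  {v | (∀ α ∈ simpleRoots n, 0 < pairing v α) ∧ pairing v (highestRoot n) < 1}

/-- `R` is a dominant region of the `m`-Shi arrangement: a connected component of the complement
of the arrangement that lies in the dominant chamber. -/
def IsDominantRegion (n m : ℕ) (R : Set (V n)) : Prop :=
  (∃ x ∈ shiComplement n m, R = connectedComponentIn (shiComplement n m) x) ∧
    R ⊆ dominantChamber n

/-- The hyperplane `H_{α,k}` separates the sets `R` and `S`: they lie strictly on opposite sides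
of it. -/
def Separates {n : ℕ} (α : Fin n → ℝ) (k : ℤ) (R S : Set (V n)) : Prop :=
  ((∀ v ∈ R, (k : ℝ) < pairing v α) ∧ ∀ v ∈ S, pairing v α < k) ∨
    ((∀ v ∈ R, pairing v α < k) ∧ ∀ v ∈ S, (k : ℝ) < pairing v α)

/-- The hyperplane `H` contains a wall (a facet, that is, a face of codimension one) of the
region `R`: the intersection of `H` with the closure of `R` affinely spans `H`. -/
def ContainsWall {n : ℕ} (H R : Set (V n)) : Prop :=
  (affineSpan ℝ (closure R ∩ H) : Set (V n)) = H

/-- The hyperplanes of the form `H_{α,m}`, `α > 0`, that separate the region `R` from `A_0` and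
contain a wall of `R`. -/
def separatingWalls (n m : ℕ) [NeZero n] (R : Set (V n)) : Set (Set (V n)) :=
  {H | ∃ α ∈ positiveRoots n, H = hyperplane α m ∧
    Separates α m R (fundamentalAlcove n) ∧ ContainsWall H R}

/-- The dominant regions of the `m`-Shi arrangement with exactly `k` walls on hyperplanes
`H_{α,m}` separating them from `A_0`. -/
def narayanaRegions (n m k : ℕ) [NeZero n] : Set (Set (V n)) :=
  {R | IsDominantRegion n m R ∧ (separatingWalls n m R).ncard = k}

/-- The `k`-th `m`-Narayana number of type `A_{n-1}`. -/
noncomputable def narayana (n m k : ℕ) [NeZero n] : ℕ := (narayanaRegions n m k).ncard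

/-! ### Core partitions

Partitions are identified with Young diagrams; the box in row `i` and column `j` is `(i, j)`, with
rows and columns numbered from `0` (this does not affect `j - i`). -/

/-- The residue `j - i mod n` of the box `(i, j)`. -/
def residue (n : ℕ) (c : ℕ × ℕ) : ZMod n := (c.2 : ZMod n) - (c.1 : ZMod n)

/-- The hook length of a box `(i, j)` of `μ`: one plus the number of boxes to the right of it plus
the number of boxes below it. (The truncated subtractions are exact for boxes of `μ`.) -/
def hookLength (μ : YoungDiagram) (c : ℕ × ℕ) : ℕ :=
  1 + (μ.rowLen c.1 - (c.2 + 1)) + (μ.colLen c.2 - (c.1 + 1))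

/-- `μ` is a `t`-core: no hook length of `μ` is divisible by `t`. -/
def IsCore (t : ℕ) (μ : YoungDiagram) : Prop := ∀ c ∈ μ.cells, ¬ t ∣ hookLength μ c

/-- The box `c` of `μ` is removable: removing it leaves the diagram of a partition. -/
def IsRemovable (μ : YoungDiagram) (c : ℕ × ℕ) : Prop :=
  c ∈ μ.cells ∧ ∃ ν : YoungDiagram, ν.cells = μ.cells.erase c

/-- The number of removable boxes of `μ` of residue `i` modulo `n`. -/
noncomputable def numRemovable (n : ℕ) (μ : YoungDiagram) (i : ZMod n) : ℕ :=
  {c : ℕ × ℕ | IsRemovable μ c ∧ residue n c = i}.ncard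

/-- The partitions `μ` that are both `n`-cores and `(mn+1)`-cores and for which there is a set `K`
of residues, `|K| = k`, such that `μ` has exactly `m` removable boxes of residue `i` if and only if
`i ∈ K`. -/
def narayanaCores (n m k : ℕ) : Set YoungDiagram :=
  {μ | IsCore n μ ∧ IsCore (m * n + 1) μ ∧
    ∃ K : Finset (ZMod n), K.card = k ∧ ∀ i : ZMod n, numRemovable n μ i = m ↔ i ∈ K}

end ShiCore

/-!
Both sides are encoded by the same objects: sequences of integers `x 0 > ⋯ > x (n - 1)` with
distinct residues modulo `n` (`IsWindow`), taken up to translation, subject to the condition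
`IsShort` that `x i - x j ≤ m * n + 1` whenever `x i` and `x j` have consecutive residues.

*Cores.* Record a partition by the set of its beads `λ_i - i`. Hook lengths are differences of
beads and gaps, so a `t`-core is a partition whose bead set is stable under subtraction of `t`
(`isCore_iff`). An `n`-core is therefore given by its largest bead in each residue class, and it is
an `(m * n + 1)`-core exactly when this window is short (`IsWindow.isShort_iff`). For a short window
the number of removable boxes of the residue of `x i` is at most `m`, with equality exactly when
`x i - x j = m * n + 1` for the entry `x j` of the preceding residue (`numRemovable_eq_iff`).

*Regions.* The point `x / n` lies in a dominant alcove, whose walls are the hyperplanes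
`v i - v j = k` with `x i - x j = k * n ± 1`. Being short means that every wall of the alcove that
separates it from `A_0` belongs to the arrangement. Each dominant region contains exactly one such
alcove: reflecting an alcove down through walls outside the arrangement ends at one
(`exists_isShort_sameCell`), and a short alcove has the smallest integer parts of all differences
`v i - v j` on its region (`IsShort.div_lt`), so that two of them agree. Finally `H_{α,m}` with
`α = ε_i - ε_j` contains a wall of the region and separates it from `A_0` exactly when
`x i - x j = m * n + 1` (`containsWall_of_eq`, `eq_of_containsWall`).

So sending a core to the region of its window is a bijection (`exists_bijOn`), and both statistics
count the pairs with `x i - x j = m * n + 1`. The key step, behind both the uniqueness and the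
description of the walls, is `IsShort.exists_between`.
-/

namespace ShiCore

/-! ### Windows -/

/-- A decreasing sequence `x 0 > ⋯ > x (n - 1)` of integers with pairwise distinct residues
modulo `n`. Up to translation these are the dominant alcoves of type `A_{n-1}`, the sequence `x`
standing for the alcove of the point `x / n`, and also the `n`-cores, `x` listing the largest bead
in each residue class. No normalization of `∑ i, x i` is imposed. -/
structure IsWindow {n : ℕ} (x : Fin n → ℤ) : Prop where
  anti : StrictAnti x
  inj : Function.Injective fun i => (x i : ZMod n)

/-- Cyclically consecutive residue classes differ by at most `m * n + 1`. For alcoves: each wall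
`H_{α,k}`, `k ≥ 1`, separating the alcove from the fundamental one has `k ≤ m`. For `n`-cores: the
core is also an `(m * n + 1)`-core. -/
def IsShort {n : ℕ} (m : ℕ) (x : Fin n → ℤ) : Prop :=
  ∀ i j, (x i : ZMod n) = x j + 1 → x i - x j ≤ m * n + 1

section Window

variable {n m : ℕ} {x y : Fin n → ℤ}

lemma IsWindow.exists_residue [NeZero n] (hx : IsWindow x) (z : ZMod n) :
    ∃ i, (x i : ZMod n) = z :=
  ((Fintype.bijective_iff_injective_and_card _).2 ⟨hx.inj, by simp⟩).2 z

lemma IsWindow.not_dvd (hx : IsWindow x) {i j : Fin n} (h : i ≠ j) :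
    ¬ (n : ℤ) ∣ x i - x j := fun hd =>
  h (hx.inj ((ZMod.intCast_eq_intCast_iff_dvd_sub _ _ _).2 hd)).symm

lemma IsWindow.mul_lt [NeZero n] (hx : IsWindow x) {i j : Fin n} (h : i ≠ j) :
    n * ((x i - x j) / n) < x i - x j :=
  lt_of_le_of_ne (Int.mul_ediv_self_le (by simp [NeZero.ne n]))
    fun he => hx.not_dvd h ⟨_, he.symm⟩

/-- If `x i - x j` is large, some `x l` in between makes the integer parts add up without carry.
Climb from `x j` to `x i` through consecutive residue classes: if no class on the way has its entry
strictly between the two, a single step has to bridge the whole of `x i - x j`, which is longer than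
a step may be. -/
lemma IsShort.exists_between [NeZero n] (hx : IsWindow x) (hs : IsShort m x) {i j : Fin n}
    (hij : i < j) (h1 : (m * n : ℤ) ≤ x i - x j) (h2 : x i - x j ≠ m * n + 1) :
    ∃ l, i < l ∧ l < j ∧ (x i - x l) / n + (x l - x j) / n = (x i - x j) / n := by
  have hn : (0 : ℤ) < n := by exact_mod_cast NeZero.pos n
  have h3 : x i - x j ≠ m * n := fun he => hx.not_dvd hij.ne ⟨m, by rw [he]; ring⟩
  by_contra! hno
  have hd := Int.emod_lt_of_pos (x i - x j) hn
  have hdiv := Int.mul_ediv_add_emod (x i - x j) n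
  have key : ∀ s : ℕ, (s : ℤ) < (x i - x j) % n → ∀ l, (x l : ZMod n) = x j + s → x l ≤ x j := by
    intro s
    induction s with
    | zero =>
      intro _ l hl
      have : l = j := hx.inj (by simpa using hl)
      rw [this]
    | succ s ih =>
      intro hsd l hl
      push_cast at hsd hl
      obtain ⟨l', hl'⟩ := hx.exists_residue ((x j : ZMod n) + s)
      have hle := ih (by linarith) l' hl'
      have hstep := hs l l' (by rw [hl, hl', add_assoc])
      by_contra! hlt
      have hli : x l < x i := by
        have : x l ≠ x i := by
          intro he
          have hli := hx.anti.injective he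
          subst hli
          have : (n : ℤ) ∣ (x l - x j) - (s + 1) := by
            rw [← ZMod.intCast_zmod_eq_zero_iff_dvd]
            push_cast
            rw [hl]; ring
          have h5 : (n : ℤ) ∣ (x l - x j) % n - (s + 1) := by
            rw [Int.emod_def, sub_right_comm]
            exact this.sub (dvd_mul_right _ _)
          have := Int.le_of_dvd (by linarith) h5
          have : (0 : ℤ) ≤ s := by positivity
          linarith
        rcases lt_or_gt_of_ne this with h | h
        · exact h
        · exfalso; omega
      have hil : i < l := hx.anti.lt_iff_gt.1 hli
      have hlj : l < j := hx.anti.lt_iff_gt.1 hlt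
      apply hno l hil hlj
      have hdvd : (n : ℤ) ∣ (x l - x j) - (s + 1) := by
        rw [← ZMod.intCast_zmod_eq_zero_iff_dvd]
        push_cast
        rw [hl]; ring
      obtain ⟨a, ha⟩ := hdvd
      have e1 : (x l - x j) / n = a := by
        rw [Int.ediv_eq_iff_of_pos hn]
        constructor <;> nlinarith
      have e2 : (x i - x l) / n = (x i - x j) / n - a := by
        rw [Int.ediv_eq_iff_of_pos hn]
        constructor <;> nlinarith
      rw [e1, e2]; ring
  have hd0 : 0 < (x i - x j) % n := by
    have := hx.mul_lt hij.ne
    linarith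
  obtain ⟨d, hdd⟩ := Int.eq_ofNat_of_zero_le (show 0 ≤ (x i - x j) % n - 1 by linarith)
  obtain ⟨l, hl⟩ := hx.exists_residue ((x j : ZMod n) + d)
  have hle := key d (by linarith) l hl
  have : (x i : ZMod n) = x l + 1 := by
    have h6 : x i = x j + d + 1 + n * ((x i - x j) / n) := by linarith
    have h7 : (x i : ZMod n) = ((x j + d + 1 + n * ((x i - x j) / n) : ℤ) : ZMod n) := by
      rw [← h6]
    rw [h7, hl]; push_cast; simp
  have := hs i l this
  omega

/-- The alcove of a short window is the lowest one in its region: lower bounds on the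
differences `v i - v j` up to level `m` propagate to all levels. -/
lemma IsShort.div_lt [NeZero n] (hx : IsWindow x) (hs : IsShort m x) {v : Fin n → ℝ}
    (h : ∀ i j, i < j → ∀ k : ℕ, k ≤ m → (k * n : ℤ) < x i - x j → (k : ℝ) < v i - v j) :
    ∀ i j, i < j → (((x i - x j) / n : ℤ) : ℝ) < v i - v j := by
  have hn : (0 : ℤ) < n := by exact_mod_cast NeZero.pos n
  suffices H : ∀ d : ℕ, ∀ i j : Fin n, i < j → (j : ℕ) - i ≤ d →
      (((x i - x j) / n : ℤ) : ℝ) < v i - v j from fun i j hij => H _ i j hij le_rfl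
  intro d
  induction d with
  | zero => intro i j hij hd; have : (i : ℕ) < j := hij; omega
  | succ d ih =>
    intro i j hij hd
    have hpos : 0 < x i - x j := sub_pos.2 (hx.anti hij)
    have hlt := hx.mul_lt hij.ne
    obtain ⟨k, hk⟩ := Int.eq_ofNat_of_zero_le (Int.ediv_nonneg hpos.le hn.le)
    by_cases hkm : k ≤ m
    · rw [hk] at hlt ⊢
      rw [mul_comm] at hlt
      simpa using h i j hij k hkm hlt
    · have hkm' : (m : ℤ) + 1 ≤ k := by exact_mod_cast Nat.lt_of_not_le hkm
      rw [hk] at hlt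
      have : ((m : ℤ) + 1) * n ≤ k * n := by gcongr
      obtain ⟨l, hil, hlj, hsum⟩ := hs.exists_between hx hij (by linarith) (by linarith)
      have hil' : (i : ℕ) < l := hil
      have hlj' : (l : ℕ) < j := hlj
      have a1 := ih i l hil (by omega)
      have a2 := ih l j hlj (by omega)
      rw [← hsum]; push_cast at a1 a2 ⊢; linarith

/-- The integer parts of the differences `(x i - x j) / n` determine `x i` up to a constant, as the
remainders run through all residues. -/
lemma IsWindow.sum_div [NeZero n] (hx : IsWindow x) (i : Fin n) :
    n * x i - ∑ j, x j = n * ∑ j, (x i - x j) / n + ∑ z : ZMod n, (z.val : ℤ) := by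
  have h1 : ∑ z : ZMod n, (z.val : ℤ) = ∑ j, (x i - x j) % n := by
    have hb : Function.Bijective fun j => ((x i - x j : ℤ) : ZMod n) := by
      rw [Fintype.bijective_iff_injective_and_card]
      refine ⟨fun a b hab => hx.inj ?_, by simp⟩
      simpa using hab
    rw [← hb.sum_comp]
    simp only [ZMod.val_intCast]
  rw [h1, Finset.mul_sum, ← Finset.sum_add_distrib]
  simp only [Int.mul_ediv_add_emod]
  simp

lemma exists_eq_add_const [NeZero n] (hx : IsWindow x) (hy : IsWindow y)
    (h : ∀ i j, i < j → (x i - x j) / n = (y i - y j) / n) : ∃ c, ∀ i, x i = y i + c := by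
  have hn : (0 : ℤ) < n := by exact_mod_cast NeZero.pos n
  have aux : ∀ z : Fin n → ℤ, IsWindow z → ∀ i j, i < j →
      (z j - z i) / n = -((z i - z j) / n) - 1 := by
    intro z hz i j hij
    have h1 := hz.mul_lt hij.ne
    have h2 := Int.mul_ediv_add_emod (z i - z j) n
    have h3 := Int.emod_lt_of_pos (z i - z j) hn
    rw [Int.ediv_eq_iff_of_pos hn]
    constructor <;> nlinarith
  have h' : ∀ i j, (x i - x j) / n = (y i - y j) / n := by
    intro i j
    rcases lt_trichotomy i j with hij | rfl | hij
    · exact h i j hij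
    · simp
    · rw [aux x hx j i hij, aux y hy j i hij, h j i hij]
  refine ⟨x 0 - y 0, fun i => ?_⟩
  have e1 := hx.sum_div i
  have e2 := hy.sum_div i
  have e3 := hx.sum_div 0
  have e4 := hy.sum_div 0
  simp only [h'] at e1 e3
  have : n * (x i - y i) = n * (x 0 - y 0) := by linarith
  have := mul_left_cancel₀ hn.ne' this
  linarith

/-- The points `x / n` and `v` lie on the same side of each hyperplane `v i - v j = k` with `i < j`
and `0 ≤ k ≤ m`, provided that neither lies on it. -/
def SameCell (m : ℕ) (x : Fin n → ℤ) (v : Fin n → ℝ) : Prop :=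
  ∀ i j, i < j → ∀ k : ℕ, k ≤ m → ((k * n : ℤ) < x i - x j ↔ (k : ℝ) < v i - v j)

/-- The window is `n * ⌊v i⌋` plus the rank of the fractional part of `v i`. -/
lemma exists_isWindow_sameCell [NeZero n] {v : Fin n → ℝ} (hv : StrictAnti v)
    (hS : ∀ i j, i < j → ∀ k : ℕ, k ≤ m → v i - v j ≠ k) :
    ∃ x : Fin n → ℤ, IsWindow x ∧ SameCell m x v := by
  have hn : (0 : ℤ) < n := by exact_mod_cast NeZero.pos n
  set f : Fin n → ℝ := fun i => Int.fract (v i) with hf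
  set ρ := (Tuple.sort f).symm with hρ
  have hmono : ∀ i j, f i < f j → ((ρ i : ℕ) : ℤ) < (ρ j : ℕ) := by
    intro i j hij
    by_contra! hle
    have hle' : ρ j ≤ ρ i := by exact_mod_cast hle
    have := Tuple.monotone_sort f hle'
    simp only [Function.comp, hρ, Equiv.apply_symm_apply] at this
    linarith
  have hlt : ∀ i, ((ρ i : ℕ) : ℤ) < n := fun i => by exact_mod_cast (ρ i).2
  have hcell : SameCell m (fun i => n * ⌊v i⌋ + ((ρ i : ℕ) : ℤ)) v := by
    intro i j hij k hk
    have hvi : v i = ⌊v i⌋ + f i := (Int.floor_add_fract _).symm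
    have hvj : v j = ⌊v j⌋ + f j := (Int.floor_add_fract _).symm
    have fi := Int.fract_lt_one (v i)
    have fj := Int.fract_lt_one (v j)
    have gi := Int.fract_nonneg (v i)
    have gj := Int.fract_nonneg (v j)
    have ri := hlt i
    have rj := hlt j
    have pi : (0 : ℤ) ≤ (ρ i : ℕ) := by positivity
    have pj : (0 : ℤ) ≤ (ρ j : ℕ) := by positivity
    generalize hF : ⌊v i⌋ - ⌊v j⌋ = F
    have e1 : (n * ⌊v i⌋ + ((ρ i : ℕ) : ℤ)) - (n * ⌊v j⌋ + ((ρ j : ℕ) : ℤ)) =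
      n * F + (((ρ i : ℕ) : ℤ) - (ρ j : ℕ)) := by rw [← hF]; ring
    have e2 : v i - v j = F + (f i - f j) := by
      rw [← hF]; push_cast; linarith
    have hiff : ∀ (r : ℝ) (a : ℤ), (0 < r ∧ r < 1 ∧ 0 < a ∧ a < n) ∨
        (r < 0 ∧ -1 < r ∧ a < 0 ∧ -n < a) → (k * n < n * F + a ↔ (k : ℝ) < F + r) := by
      intro r a hra
      rcases hra with ⟨h1, h2, h3, h4⟩ | ⟨h1, h2, h3, h4⟩
      · have l1 : k * n < n * F + a ↔ (k : ℤ) ≤ F := by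
          constructor
          · intro h; by_contra! hlt
            have : F + 1 ≤ k := hlt
            nlinarith
          · intro h; nlinarith
        have l2 : (k : ℝ) < F + r ↔ (k : ℤ) ≤ F := by
          constructor
          · intro h; by_contra! hlt
            have : ((F + 1 : ℤ) : ℝ) ≤ (k : ℤ) := by exact_mod_cast hlt
            push_cast at this; linarith
          · intro h
            have : (((k : ℤ)) : ℝ) ≤ F := by exact_mod_cast h
            push_cast at this; linarith
        rw [l1, l2]
      · have l1 : k * n < n * F + a ↔ (k : ℤ) < F := by
          constructor
          · intro h; by_contra! hlt
            nlinarith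
          · intro h
            have : (k : ℤ) + 1 ≤ F := h
            nlinarith
        have l2 : (k : ℝ) < F + r ↔ (k : ℤ) < F := by
          constructor
          · intro h; by_contra! hlt
            have : (F : ℝ) ≤ (k : ℤ) := by exact_mod_cast hlt
            push_cast at this; linarith
          · intro h
            have : (((k + 1 : ℤ)) : ℝ) ≤ F := by exact_mod_cast h
            push_cast at this; linarith
        rw [l1, l2]
    rw [e1, e2]
    rcases lt_trichotomy (f i) (f j) with hlt | heq | hlt
    · have := hmono i j hlt
      exact hiff _ _ (Or.inr ⟨by linarith, by linarith, by linarith, by linarith⟩)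
    -- Equal fractional parts make `v i - v j` an integer, so it exceeds `m`; the tie-breaking in the
    -- rank, which may lower the quotient by one, is then harmless.
    · rw [heq, sub_self, add_zero] at e2
      have hFm : (m : ℤ) < F := by
        by_contra! hle
        have hF0 : 0 ≤ F := by
          have : (0 : ℝ) < F := by rw [← e2]; exact sub_pos.2 (hv hij)
          exact_mod_cast this.le
        obtain ⟨N, rfl⟩ := Int.eq_ofNat_of_zero_le hF0
        exact hS i j hij N (by exact_mod_cast hle) (by rw [e2]; simp)
      have hkF : (k : ℤ) + 1 ≤ F := by have : (k : ℤ) ≤ m := by exact_mod_cast hk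
                                       linarith
      have hkF' : ((k + 1 : ℤ) : ℝ) ≤ F := by exact_mod_cast hkF
      push_cast at hkF'
      refine iff_of_true ?_ (by rw [heq]; linarith)
      nlinarith
    · have := hmono j i hlt
      exact hiff _ _ (Or.inl ⟨by linarith, by linarith, by linarith, by linarith⟩)
  refine ⟨_, ⟨?_, ?_⟩, hcell⟩
  · intro i j hij
    have := (hcell i j hij 0 (Nat.zero_le _)).2 (by simpa using hv hij)
    simpa using this
  · intro i j hij
    simp only [Int.cast_add, Int.cast_mul, Int.cast_natCast, ZMod.natCast_self, zero_mul,
      zero_add] at hij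
    rw [ZMod.natCast_eq_natCast_iff'] at hij
    rw [Nat.mod_eq_of_lt (ρ i).2, Nat.mod_eq_of_lt (ρ j).2] at hij
    exact ρ.injective (Fin.ext hij)

/-- Among the windows in a cell, one minimizing `∑ i, x i ^ 2` is short: if `x p - x q = k * n + 1`
with `k > m`, replacing `x p`, `x q` by `x p - 1`, `x q + 1` (a reflection of the alcove in one of
its walls) stays in the cell and lowers the sum. -/
lemma exists_isShort_sameCell [NeZero n] {v : Fin n → ℝ} (hv : StrictAnti v)
    (hS : ∀ i j, i < j → ∀ k : ℕ, k ≤ m → v i - v j ≠ k) :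
    ∃ x : Fin n → ℤ, IsWindow x ∧ IsShort m x ∧ SameCell m x v := by
  have hn : (0 : ℤ) < n := by exact_mod_cast NeZero.pos n
  obtain ⟨x, hx, hmin⟩ := exists_minimalFor_of_wellFoundedLT
    (fun x : Fin n → ℤ => IsWindow x ∧ SameCell m x v) (fun x => ∑ i, (x i).natAbs ^ 2)
    (exists_isWindow_sameCell hv hS)
  obtain ⟨hx, hc⟩ := hx
  refine ⟨x, hx, ?_, hc⟩
  intro p q hpq
  by_contra! hlt
  have hpq' : x q < x p := by have : (0 : ℤ) ≤ m * n := by positivity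
                              linarith
  have hne : p ≠ q := by rintro rfl; exact lt_irrefl _ hpq'
  have hltpq : p < q := hx.anti.lt_iff_gt.1 hpq'
  set y : Fin n → ℤ := fun i => x i + (if i = q then 1 else 0) - (if i = p then 1 else 0) with hy
  have hyr : ∀ i, (y i : ZMod n) = x (Equiv.swap p q i) := by
    intro i
    by_cases h1 : i = p
    · subst h1; simp [hy, hne, hpq]
    · by_cases h2 : i = q
      · subst h2; simp [hy, hne.symm, hpq]
      · simp [hy, h1, h2, Equiv.swap_apply_of_ne_of_ne h1 h2]
  have hyinj : Function.Injective fun i => (y i : ZMod n) := by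
    intro i j hij
    simp only [hyr] at hij
    exact (Equiv.swap p q).injective (hx.inj hij)
  have hynd : ∀ i j, i ≠ j → ¬ (n : ℤ) ∣ y i - y j := fun i j h hd =>
    h (hyinj ((ZMod.intCast_eq_intCast_iff_dvd_sub _ _ _).2 hd)).symm
  have hxy : ∀ i j, i < j → ∀ k : ℕ, k ≤ m → ((k * n : ℤ) < x i - x j ↔ (k * n : ℤ) < y i - y j) := by
    intro i j hij k hk
    by_cases hijpq : i = p ∧ j = q
    · obtain ⟨rfl, rfl⟩ := hijpq
      have hkm : (k * n : ℤ) ≤ m * n := by gcongr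
      have e : y i - y j = x i - x j - 2 := by simp [hy, hne, hne.symm]; ring
      have h1 := hynd i j hne
      rw [e] at h1 ⊢
      refine iff_of_true (by linarith) (lt_of_le_of_ne (by linarith) ?_)
      intro he
      exact h1 ⟨k, by rw [← he]; ring⟩
    · have h1 := hx.not_dvd hij.ne
      have h2 := hynd i j hij.ne
      have h3 : (x i - x j) ≠ k * n := fun he => h1 ⟨k, by rw [he]; ring⟩
      have h4 : (y i - y j) ≠ k * n := fun he => h2 ⟨k, by rw [he]; ring⟩
      -- Neither difference is a multiple of `n`, so a change by at most one crosses no multiple.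
      have h5 : |(y i - y j) - (x i - x j)| ≤ 1 := by
        simp only [hy]
        rw [abs_le]
        split_ifs <;> first | (constructor <;> linarith) | (exfalso; subst_vars; first
          | exact hijpq ⟨rfl, rfl⟩ | exact lt_asymm hij hltpq)
      rw [abs_le] at h5
      omega
  have hyw : IsWindow y := by
    refine ⟨fun i j hij => ?_, hyinj⟩
    have := (hxy i j hij 0 (Nat.zero_le _)).1 (by simpa using hx.anti hij)
    simpa using this
  have := hmin (j := y) ⟨hyw, fun i j hij k hk => (hxy i j hij k hk).symm.trans (hc i j hij k hk)⟩
  have hsum : ∑ i, (y i) ^ 2 < ∑ i, (x i) ^ 2 := by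
    have e : ∀ i, y i ^ 2 = x i ^ 2 + ((if i = q then 2 * x q + 1 else 0) -
        (if i = p then 2 * x p - 1 else 0)) := by
      intro i
      by_cases h1 : i = p
      · subst h1; simp [hy, hne]; ring
      · by_cases h2 : i = q
        · subst h2; simp [hy, h1]; ring
        · simp [hy, h1, h2]
    simp only [e, Finset.sum_add_distrib, Finset.sum_sub_distrib, Finset.sum_ite_eq',
      Finset.mem_univ, if_true]
    have : (0 : ℤ) ≤ m * n := by positivity
    linarith
  have hcast : ∀ z : Fin n → ℤ, ((∑ i, (z i).natAbs ^ 2 : ℕ) : ℤ) = ∑ i, z i ^ 2 := by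
    intro z; push_cast; simp
  have h9 : ∑ i, (y i).natAbs ^ 2 < ∑ i, (x i).natAbs ^ 2 := by
    zify; simpa using hsum
  exact absurd (this h9.le) (not_le.2 h9)

lemma exists_eq_add_const_of_sameCell [NeZero n] {v : Fin n → ℝ} (hx : IsWindow x)
    (hy : IsWindow y) (hsx : IsShort m x) (hsy : IsShort m y) (hcx : SameCell m x v)
    (hcy : SameCell m y v) : ∃ c, ∀ i, x i = y i + c := by
  have hn : (0 : ℤ) < n := by exact_mod_cast NeZero.pos n
  have aux : ∀ a b : Fin n → ℤ, IsWindow a → IsShort m a → SameCell m a v → SameCell m b v →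
      ∀ i j, i < j → (a i - a j) / n ≤ (b i - b j) / n := by
    intro a b ha hsa hca hcb i j hij
    have := hsa.div_lt ha (v := fun i => (b i : ℝ) / n) (fun i j hij k hk h => by
      have h1 := (hcb i j hij k hk).2 ((hca i j hij k hk).1 h)
      have h2 : ((k * n : ℤ) : ℝ) < ((b i - b j : ℤ) : ℝ) := by exact_mod_cast h1
      have hn' : (0 : ℝ) < n := by exact_mod_cast hn
      rw [← sub_div, lt_div_iff₀ hn']
      push_cast at h2; exact h2) i j hij
    have hn' : (0 : ℝ) < n := by exact_mod_cast hn
    rw [← sub_div, lt_div_iff₀ hn'] at this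
    rw [Int.le_ediv_iff_mul_le hn]
    exact_mod_cast this.le
  exact exists_eq_add_const hx hy fun i j hij =>
    le_antisymm (aux x y hx hsx hcx hcy i j hij) (aux y x hy hsy hcy hcx i j hij)

end Window

/-! ### Partitions as bead configurations -/

section Beads

variable {μ ν : YoungDiagram}

/-- The position `λ_i - i` of the `i`-th bead of the partition on the line `ℤ` (rows and positions
shifted so that the empty partition has its beads at the negative integers). -/
def bead (μ : YoungDiagram) (i : ℕ) : ℤ := μ.rowLen i - i - 1

/-- The position of the `j`-th empty place, counted from the left, in the bead configuration. -/
def gap (μ : YoungDiagram) (j : ℕ) : ℤ := j - μ.colLen j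

/-- The set of beads of a partition; its complement consists of the gaps, see
`notMem_beads_iff`. -/
def beads (μ : YoungDiagram) : Set ℤ := Set.range (bead μ)

lemma bead_strictAnti (μ : YoungDiagram) : StrictAnti (bead μ) := by
  intro i j hij
  have := μ.rowLen_anti i j hij.le
  simp only [bead]; omega

lemma gap_lt_bead_iff {i j : ℕ} : gap μ j < bead μ i ↔ (i, j) ∈ μ := by
  have h1 := YoungDiagram.mem_iff_lt_rowLen (μ := μ) (i := i) (j := j)
  have h2 := YoungDiagram.mem_iff_lt_colLen (μ := μ) (i := i) (j := j)
  by_cases h : (i, j) ∈ μ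
  · have := h1.1 h
    have := h2.1 h
    simp only [h, iff_true, bead, gap]; omega
  · have := mt h1.2 h
    have := mt h2.2 h
    simp only [h, iff_false, bead, gap]; omega

lemma bead_ne_gap (i j : ℕ) : bead μ i ≠ gap μ j := by
  have h1 := YoungDiagram.mem_iff_lt_rowLen (μ := μ) (i := i) (j := j)
  have h2 := YoungDiagram.mem_iff_lt_colLen (μ := μ) (i := i) (j := j)
  by_cases h : (i, j) ∈ μ
  · exact (gap_lt_bead_iff.2 h).ne'
  · have := mt h1.2 h
    have := mt h2.2 h
    simp only [bead, gap]; omega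

lemma rowLen_eq_zero {i : ℕ} (hi : μ.colLen 0 ≤ i) : μ.rowLen i = 0 := by
  by_contra h
  have := YoungDiagram.mem_iff_lt_colLen.1
    (YoungDiagram.mem_iff_lt_rowLen.2 (Nat.pos_of_ne_zero h))
  omega

lemma notMem_beads_iff {p : ℤ} : p ∉ beads μ ↔ ∃ j, gap μ j = p := by
  constructor
  · intro hp
    have hex : ∃ i, bead μ i < p := by
      refine ⟨μ.colLen 0 + p.natAbs, ?_⟩
      simp only [bead, rowLen_eq_zero (Nat.le_add_right _ _)]
      omega
    set i := Nat.find hex with hi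
    have h1 : bead μ i < p := Nat.find_spec hex
    have h2 : ∀ i' < i, p < bead μ i' := fun i' h =>
      lt_of_le_of_ne (not_lt.1 (Nat.find_min hex h)) fun he => hp ⟨i', he.symm⟩
    simp only [bead] at h1 h2
    obtain ⟨j, hj⟩ := Int.eq_ofNat_of_zero_le (show 0 ≤ p + i by omega)
    refine ⟨j, ?_⟩
    have h3 : μ.colLen j = i := by
      apply le_antisymm
      · by_contra! h
        have := YoungDiagram.mem_iff_lt_rowLen.1 (YoungDiagram.mem_iff_lt_colLen.2 h)
        omega
      · rcases Nat.eq_zero_or_pos i with h0 | h0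
        · omega
        · have := h2 (i - 1) (by omega)
          have := YoungDiagram.mem_iff_lt_colLen.1
            (YoungDiagram.mem_iff_lt_rowLen.2 (show j < μ.rowLen (i - 1) by omega))
          omega
    simp only [gap]; omega
  · rintro ⟨j, rfl⟩ ⟨i, hi⟩
    exact bead_ne_gap i j hi

lemma hookLength_eq {i j : ℕ} (h : (i, j) ∈ μ) :
    (hookLength μ (i, j) : ℤ) = bead μ i - gap μ j := by
  have := YoungDiagram.mem_iff_lt_rowLen.1 h
  have := YoungDiagram.mem_iff_lt_colLen.1 h
  simp only [hookLength, bead, gap]; omega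

/-- Hook lengths are the differences `bead - gap` that are positive, so `μ` is a `t`-core
exactly when its bead set is stable under translation by `-t`. -/
lemma isCore_iff {t : ℕ} (ht : 0 < t) : IsCore t μ ↔ ∀ p ∈ beads μ, p - t ∈ beads μ := by
  constructor
  · rintro h _ ⟨i, rfl⟩
    by_contra hp
    obtain ⟨j, hj⟩ := notMem_beads_iff.1 hp
    have hij : (i, j) ∈ μ := gap_lt_bead_iff.1 (by omega)
    refine h (i, j) hij ?_
    have := hookLength_eq hij
    rw [hj] at this
    have : hookLength μ (i, j) = t := by omega
    rw [this]
  · rintro h ⟨i, j⟩ hij ⟨s, hs⟩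
    have hh := hookLength_eq hij
    have hmem : ∀ s : ℕ, bead μ i - t * s ∈ beads μ := by
      intro s
      induction s with
      | zero => simp [beads]
      | succ s ih => have := h _ ih; push_cast; rwa [mul_add, mul_one, ← sub_sub]
    refine notMem_beads_iff.2 ⟨j, ?_⟩ (hmem s)
    rw [hs] at hh; push_cast at hh; linarith

lemma isRemovable_iff {i j : ℕ} :
    IsRemovable μ (i, j) ↔ μ.rowLen i = j + 1 ∧ μ.colLen j = i + 1 := by
  constructor
  · rintro ⟨hm, ν, hν⟩
    have hmem : ∀ c, c ∈ ν ↔ c ≠ (i, j) ∧ c ∈ μ := by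
      intro c; rw [← YoungDiagram.mem_cells, hν, Finset.mem_erase, YoungDiagram.mem_cells]
    have h0 : (i, j) ∉ ν := by simp [hmem]
    have h1 : (i + 1, j) ∉ μ := fun h =>
      h0 (ν.up_left_mem (Nat.le_succ i) le_rfl ((hmem _).2 ⟨by simp, h⟩))
    have h2 : (i, j + 1) ∉ μ := fun h =>
      h0 (ν.up_left_mem le_rfl (Nat.le_succ j) ((hmem _).2 ⟨by simp, h⟩))
    rw [YoungDiagram.mem_cells] at hm
    have := YoungDiagram.mem_iff_lt_rowLen.1 hm
    have := YoungDiagram.mem_iff_lt_colLen.1 hm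
    rw [YoungDiagram.mem_iff_lt_colLen] at h1
    rw [YoungDiagram.mem_iff_lt_rowLen] at h2
    omega
  · rintro ⟨h1, h2⟩
    have hm : (i, j) ∈ μ := YoungDiagram.mem_iff_lt_rowLen.2 (by omega)
    refine ⟨hm, ⟨μ.cells.erase (i, j), ?_⟩, rfl⟩
    rintro ⟨a, b⟩ ⟨a', b'⟩ hle hab
    obtain ⟨ha, hb⟩ := Prod.mk_le_mk.1 hle
    simp only [Finset.coe_erase, Set.mem_sdiff, Finset.mem_coe, YoungDiagram.mem_cells,
      Set.mem_singleton_iff, Prod.mk.injEq] at hab ⊢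
    refine ⟨μ.up_left_mem ha hb hab.1, ?_⟩
    rintro ⟨rfl, rfl⟩
    apply hab.2
    have e1 := YoungDiagram.mem_iff_lt_rowLen.1 (μ.up_left_mem ha le_rfl hab.1)
    have e2 := YoungDiagram.mem_iff_lt_colLen.1 (μ.up_left_mem le_rfl hb hab.1)
    omega

/-- A removable box of residue `r` is a bead in the class `r` whose left neighbour is a gap. -/
lemma numRemovable_eq (n : ℕ) (μ : YoungDiagram) (r : ZMod n) :
    numRemovable n μ r = {p : ℤ | p ∈ beads μ ∧ p - 1 ∉ beads μ ∧ (p : ZMod n) = r}.ncard := by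
  have himg : {p : ℤ | p ∈ beads μ ∧ p - 1 ∉ beads μ ∧ (p : ZMod n) = r} =
      (fun c : ℕ × ℕ => (c.2 : ℤ) - c.1) '' {c | IsRemovable μ c ∧ residue n c = r} := by
    ext p
    constructor
    · rintro ⟨⟨i, hi⟩, hp, hr⟩
      obtain ⟨j, hj⟩ := notMem_beads_iff.1 hp
      have hij : (i, j) ∈ μ := gap_lt_bead_iff.1 (by omega)
      have e1 := YoungDiagram.mem_iff_lt_rowLen.1 hij
      have e2 := YoungDiagram.mem_iff_lt_colLen.1 hij
      simp only [bead, gap] at hi hj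
      have e3 : (j : ℤ) - i = p := by omega
      refine ⟨(i, j), ⟨isRemovable_iff.2 (by omega), ?_⟩, e3⟩
      rw [← hr, ← e3]; simp [residue]
    · rintro ⟨⟨i, j⟩, ⟨h1, h2⟩, rfl⟩
      obtain ⟨h3, h4⟩ := isRemovable_iff.1 h1
      refine ⟨⟨i, ?_⟩, notMem_beads_iff.2 ⟨j, ?_⟩, ?_⟩
      · simp only [bead]; omega
      · simp only [gap]; omega
      · rw [← h2]; simp [residue]
  rw [himg, Set.InjOn.ncard_image]
  · rfl
  · rintro ⟨i, j⟩ ⟨h1, -⟩ ⟨i', j'⟩ ⟨h2, -⟩ he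
    have e1 := isRemovable_iff.1 h1
    have e2 := isRemovable_iff.1 h2
    simp only at he
    have : i = i' := (bead_strictAnti μ).injective (by simp only [bead]; omega)
    subst this
    simp only [Prod.mk.injEq, true_and]; omega

/-- Bead sets of distinct partitions are not translates of each other. -/
lemma eq_of_beads {c : ℤ} (h : ∀ p, p ∈ beads μ ↔ p + c ∈ beads ν) : μ = ν := by
  have hr : Set.range (fun i => -(bead μ i + c)) = Set.range fun i => -bead ν i := by
    ext q
    have := h (-q - c)
    simp only [beads, Set.mem_range, sub_add_cancel] at this ⊢
    simpa only [eq_sub_iff_add_eq, neg_eq_iff_eq_neg] using this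
  rw [StrictMono.range_inj
    (fun i j hij => neg_lt_neg (add_lt_add_left (bead_strictAnti μ hij) c))
    (fun i j hij => neg_lt_neg (bead_strictAnti ν hij))] at hr
  have hr' : ∀ i, bead μ i + c = bead ν i := fun i => neg_injective (congrFun hr i)
  have hc : c = 0 := by
    have := hr' (μ.colLen 0 + ν.colLen 0)
    simpa only [bead, rowLen_eq_zero (Nat.le_add_right _ _), rowLen_eq_zero (Nat.le_add_left _ _),
      add_eq_left] using this
  ext ⟨i, j⟩
  have := hr' i
  simp only [bead] at this
  rw [YoungDiagram.mem_cells, YoungDiagram.mem_cells, YoungDiagram.mem_iff_lt_rowLen,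
    YoungDiagram.mem_iff_lt_rowLen]
  omega

lemma exists_youngDiagram_rowLen {r : ℕ → ℕ} (hr : Antitone r) {N : ℕ} (hN : r N = 0) :
    ∃ μ : YoungDiagram, ∀ i, μ.rowLen i = r i := by
  set S : Finset (ℕ × ℕ) := (Finset.range N ×ˢ Finset.range (r 0)).filter fun c => c.2 < r c.1
    with hS
  have hmem : ∀ i j, (i, j) ∈ S ↔ j < r i := by
    intro i j
    simp only [hS, Finset.mem_filter, Finset.mem_product, Finset.mem_range, and_iff_right_iff_imp]
    intro hj
    refine ⟨?_, hj.trans_le (hr (Nat.zero_le i))⟩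
    by_contra! hle
    have := hr hle
    omega
  have hlow : IsLowerSet (S : Set (ℕ × ℕ)) := by
    rintro ⟨a, b⟩ ⟨a', b'⟩ hle hab
    obtain ⟨ha, hb⟩ := Prod.mk_le_mk.1 hle
    rw [Finset.mem_coe, hmem] at hab ⊢
    exact (hb.trans_lt hab).trans_le (hr ha)
  refine ⟨⟨S, hlow⟩, fun i => eq_of_forall_lt_iff fun j => ?_⟩
  rw [← YoungDiagram.mem_iff_lt_rowLen, YoungDiagram.mem_mk, hmem]

/-- A set of integers that is bounded above and contains all sufficiently small integers is a
translate of a bead set. -/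
lemma exists_beads {B : Set ℤ} {M N : ℤ} (hM : ∀ p ∈ B, p ≤ M) (hN : ∀ p ≤ N, p ∈ B) :
    ∃ (μ : YoungDiagram) (c : ℤ), ∀ p, p ∈ beads μ ↔ p + c ∈ B := by
  set D : ℕ → Prop := fun q => M - q ∈ B with hD
  set Q := (M - N).toNat with hQ
  have hDQ : ∀ q, Q ≤ q → D q := fun q hq => hN _ (by omega)
  have hinf : (Set.ofPred D).Infinite := (Set.Ici_infinite Q).mono fun q hq => hDQ q hq
  have hmono := Nat.nth_strictMono hinf
  have hrange : ∀ q, D q ↔ ∃ i, Nat.nth D i = q := fun q => by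
    have := Nat.range_nth_of_infinite hinf
    exact (Set.ext_iff.1 this q).symm
  have hstep : ∀ i, Nat.nth D i + 1 ≤ Nat.nth D (i + 1) := fun i => hmono (Nat.lt_succ_self i)
  have hev : ∀ k, Nat.nth D (Q + k) = Nat.nth D Q + k := by
    intro k
    induction k with
    | zero => rfl
    | succ k ih =>
      have h1 : Q ≤ Nat.nth D (Q + k) := le_trans (Nat.le_add_right _ _) (hmono.le_apply)
      obtain ⟨l, hl⟩ := (hrange _).1 (hDQ (Nat.nth D (Q + k) + 1) (by omega))
      have h2 : Q + k < l := hmono.lt_iff_lt.1 (by omega)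
      have h3 : Nat.nth D (Q + k + 1) ≤ Nat.nth D l := hmono.monotone h2
      have h4 := hstep (Q + k)
      rw [← add_assoc]
      omega
  have hsub : Monotone fun i => (Nat.nth D i : ℤ) - i := monotone_nat_of_le_succ fun i => by
    have := hstep i
    push_cast; omega
  -- Number the elements of `B` downwards from `M`; the number of missing integers passed before the
  -- `i`-th one grows to a final value `C`, and the `i`-th row is what is still missing.
  obtain ⟨C, hC⟩ : ∃ C : ℤ, (Nat.nth D Q : ℤ) - Q = C := ⟨_, rfl⟩
  have hle : ∀ i, (Nat.nth D i : ℤ) - i ≤ C := by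
    intro i
    rcases le_total i Q with h | h
    · rw [← hC]; exact hsub h
    · obtain ⟨k, rfl⟩ := Nat.exists_eq_add_of_le h
      rw [hev, ← hC]; push_cast; omega
  obtain ⟨μ, hμ⟩ := exists_youngDiagram_rowLen (r := fun i => (C - (Nat.nth D i - i)).toNat)
    (fun i j hij => by have := hsub hij; simp only at this ⊢; omega) (N := Q) (by simp [hC])
  have hb : ∀ i, bead μ i = C - 1 - Nat.nth D i := by
    intro i
    have := hle i
    simp only [bead, hμ]; omega
  refine ⟨μ, M - C + 1, fun p => ?_⟩
  constructor
  · rintro ⟨i, rfl⟩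
    have : D (Nat.nth D i) := Nat.nth_mem_of_infinite hinf i
    rw [hb]; simp only [hD] at this
    convert this using 1; ring
  · intro hp
    have h1 := hM _ hp
    obtain ⟨q, hq⟩ := Int.eq_ofNat_of_zero_le (show 0 ≤ M - (p + (M - C + 1)) by omega)
    obtain ⟨i, hi⟩ := (hrange q).1 (by
      simp only [hD]
      convert hp using 1; omega)
    refine ⟨i, ?_⟩
    rw [hb, hi]; omega

end Beads

/-! ### Dominant regions of the Shi arrangement and their walls -/

section Geometry

variable {n m : ℕ}

lemma pairing_root (v : V n) (i j : Fin n) : pairing v (root i j) = v.1 i - v.1 j := by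
  simp [pairing, root, dotProduct_sub]

lemma mem_hyperplane_root {v : V n} {i j : Fin n} {k : ℤ} :
    v ∈ hyperplane (root i j) k ↔ v.1 i - v.1 j = k := by
  rw [hyperplane, Set.mem_ofPred_eq, pairing_root]

lemma continuous_coord_sub (i j : Fin n) : Continuous fun v : V n => v.1 i - v.1 j :=
  ((continuous_apply i).comp continuous_subtype_val).sub
    ((continuous_apply j).comp continuous_subtype_val)

/-- The orthogonal projection of `ℝⁿ` onto `V`; it preserves all differences of coordinates. -/
noncomputable def center [NeZero n] (u : Fin n → ℝ) : V n :=
  ⟨fun i => u i - (∑ j, u j) / n, by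
    have : (n : ℝ) ≠ 0 := by exact_mod_cast NeZero.ne n
    change ∑ i, (u i - (∑ j, u j) / n) = 0
    simp [Finset.sum_sub_distrib, mul_div_cancel₀, this]⟩

lemma center_sub [NeZero n] (u : Fin n → ℝ) (i j : Fin n) :
    (center u).1 i - (center u).1 j = u i - u j := by
  simp [center]

/-- The point `x / n` of the alcove of the window `x`, projected to `V`. -/
noncomputable def point [NeZero n] (x : Fin n → ℤ) : V n := center fun i => (x i : ℝ) / n

lemma point_sub [NeZero n] (x : Fin n → ℤ) (i j : Fin n) :
    (point x).1 i - (point x).1 j = ((x i - x j : ℤ) : ℝ) / n := by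
  rw [point, center_sub]; push_cast; ring

/-- The region of the `m`-Shi arrangement containing the alcove of the window `x`. Dominance is the
case `k = 0`. -/
def region (m : ℕ) (x : Fin n → ℤ) : Set (V n) :=
  {v | ∀ i j, i < j → ∀ k : ℕ, k ≤ m → ((k * n : ℤ) < x i - x j → (k : ℝ) < v.1 i - v.1 j) ∧
    (x i - x j < k * n → v.1 i - v.1 j < k)}

lemma region_add_const {x y : Fin n → ℤ} {c : ℤ} (h : ∀ i, x i = y i + c) :
    region m x = region m y := by
  simp only [region, h, add_sub_add_right_eq_sub]

lemma strictAnti_of_simple {v : Fin n → ℝ} (h : ∀ i j : Fin n, (i : ℕ) + 1 = j → v j < v i) :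
    StrictAnti v := by
  cases n with
  | zero => exact fun i => i.elim0
  | succ n => exact Fin.strictAnti_iff_succ_lt.2 fun i => h _ _ (by simp)

variable {x y : Fin n → ℤ}

lemma IsWindow.ne_mul (hx : IsWindow x) {i j : Fin n} (h : i ≠ j) (k : ℕ) :
    x i - x j ≠ k * n := fun he => hx.not_dvd h ⟨k, by rw [he, mul_comm]⟩

lemma convex_region (m : ℕ) (x : Fin n → ℤ) : Convex ℝ (region m x) := by
  intro v hv w hw a b ha hb hab i j hij k hk
  have e : (a • v + b • w).1 i - (a • v + b • w).1 j =
      a • (v.1 i - v.1 j) + b • (w.1 i - w.1 j) := by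
    simp; ring
  rw [e]
  exact ⟨fun h => convex_Ioi (k : ℝ) ((hv i j hij k hk).1 h) ((hw i j hij k hk).1 h) ha hb hab,
    fun h => convex_Iio (k : ℝ) ((hv i j hij k hk).2 h) ((hw i j hij k hk).2 h) ha hb hab⟩

lemma IsWindow.strictAnti_of_mem_region (hx : IsWindow x) {v : V n} (hv : v ∈ region m x) :
    StrictAnti v.1 := fun i j hij => by
  have := (hv i j hij 0 (Nat.zero_le _)).1 (by simpa using hx.anti hij)
  simpa using this

lemma le_of_mem_closure_region {v : V n} (hv : v ∈ closure (region m x)) {i j : Fin n}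
    (hij : i < j) {k : ℕ} (hk : k ≤ m) (h : (k * n : ℤ) < x i - x j) :
    (k : ℝ) ≤ v.1 i - v.1 j :=
  closure_minimal (t := {v : V n | (k : ℝ) ≤ v.1 i - v.1 j})
    (fun _ hw => ((hw i j hij k hk).1 h).le)
    (isClosed_le continuous_const (continuous_coord_sub i j)) hv

lemma IsWindow.sameCell_of_mem_region (hx : IsWindow x) {v : V n} (hv : v ∈ region m x) :
    SameCell m x v.1 := fun i j hij k hk => by
  refine ⟨(hv i j hij k hk).1, fun h => ?_⟩
  by_contra! hle
  exact lt_asymm h ((hv i j hij k hk).2 (lt_of_le_of_ne hle (hx.ne_mul hij.ne k)))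

lemma IsWindow.region_subset_shiComplement (hx : IsWindow x) : region m x ⊆ shiComplement n m := by
  rintro v hv _ ⟨i, j, hij, rfl⟩ k - hkm hvk
  rw [mem_hyperplane_root] at hvk
  have hpos : (0 : ℝ) < k := by rw [← hvk]; exact sub_pos.2 (hx.strictAnti_of_mem_region hv hij)
  obtain ⟨k, rfl⟩ := Int.eq_ofNat_of_zero_le (by exact_mod_cast hpos.le : 0 ≤ k)
  have hk : k ≤ m := by exact_mod_cast hkm
  have h := hv i j hij k hk
  rw [hvk] at h
  rcases lt_or_gt_of_ne (hx.ne_mul hij.ne k) with h' | h'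
  · exact lt_irrefl _ (h.2 h')
  · exact lt_irrefl _ (h.1 h')

section Region

variable [NeZero n]

lemma natCast_lt_div {k : ℕ} {a : ℤ} : (k : ℝ) < (a : ℝ) / n ↔ (k * n : ℤ) < a := by
  have hn : (0 : ℝ) < n := by exact_mod_cast NeZero.pos n
  rw [lt_div_iff₀ hn]; exact_mod_cast Iff.rfl

lemma div_lt_natCast {k : ℕ} {a : ℤ} : (a : ℝ) / n < k ↔ a < k * n := by
  have hn : (0 : ℝ) < n := by exact_mod_cast NeZero.pos n
  rw [div_lt_iff₀ hn]; exact_mod_cast Iff.rfl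

lemma point_mem_region (x : Fin n → ℤ) : point x ∈ region m x := fun i j _ k _ => by
  rw [point_sub, natCast_lt_div, div_lt_natCast]
  exact ⟨id, id⟩

lemma IsWindow.connectedComponentIn_point (hm : 1 ≤ m) (hx : IsWindow x) :
    connectedComponentIn (shiComplement n m) (point x) = region m x := by
  apply subset_antisymm
  · intro y hy i j hij k hk
    have hS := hx.region_subset_shiComplement (point_mem_region (m := m) x)
    have hp := mem_connectedComponentIn hS
    have hc : ContinuousOn (fun v : V n => v.1 i - v.1 j)
      (connectedComponentIn (shiComplement n m) (point x)) := (continuous_coord_sub i j).continuousOn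
    have hne : ∀ v ∈ connectedComponentIn (shiComplement n m) (point x), v.1 i - v.1 j ≠ k := by
      intro v hv he
      refine connectedComponentIn_subset _ _ hv _ ⟨i, j, hij, rfl⟩ (k : ℤ) (by omega)
        (by exact_mod_cast hk) ?_
      rw [mem_hyperplane_root, he]; simp
    have hpr := point_mem_region (m := m) x i j hij k hk
    constructor
    · intro h
      by_contra! hle
      obtain ⟨v, hv, he⟩ := isPreconnected_connectedComponentIn.intermediate_value hy hp hc
        ⟨hle, (hpr.1 h).le⟩
      exact hne v hv he
    · intro h
      by_contra! hle
      obtain ⟨v, hv, he⟩ := isPreconnected_connectedComponentIn.intermediate_value hp hy hc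
        ⟨(hpr.2 h).le, hle⟩
      exact hne v hv he
  · exact (convex_region m x).isPreconnected.subset_connectedComponentIn (point_mem_region x)
      hx.region_subset_shiComplement

lemma IsWindow.isDominantRegion (hm : 1 ≤ m) (hx : IsWindow x) :
    IsDominantRegion n m (region m x) := by
  refine ⟨⟨point x, hx.region_subset_shiComplement (point_mem_region x),
    (hx.connectedComponentIn_point hm).symm⟩, ?_⟩
  rintro v hv _ ⟨i, j, hij, rfl⟩
  rw [pairing_root]
  exact (sub_pos.2 (hx.strictAnti_of_mem_region hv (Fin.lt_def.2 (by omega)))).le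

/-- Each dominant region contains the alcove of a short window. -/
lemma IsDominantRegion.exists_isShort (hm : 1 ≤ m) {R : Set (V n)} (hR : IsDominantRegion n m R) :
    ∃ x : Fin n → ℤ, IsWindow x ∧ IsShort m x ∧ R = region m x := by
  obtain ⟨⟨v, hv, rfl⟩, hdom⟩ := hR
  have hdv := hdom (mem_connectedComponentIn hv)
  have hanti : StrictAnti v.1 := by
    refine strictAnti_of_simple fun i j hij => ?_
    have h1 := hdv _ ⟨i, j, hij, rfl⟩
    have h2 := hv _ ⟨i, j, Fin.lt_def.2 (by omega), rfl⟩ 0 (by omega) (by omega)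
    rw [pairing_root] at h1
    rw [mem_hyperplane_root, Int.cast_zero] at h2
    exact sub_pos.1 (lt_of_le_of_ne h1 (Ne.symm h2))
  have hS : ∀ i j, i < j → ∀ k : ℕ, k ≤ m → v.1 i - v.1 j ≠ k := by
    intro i j hij k hk he
    refine hv _ ⟨i, j, hij, rfl⟩ k (by omega) (by exact_mod_cast hk) ?_
    rw [mem_hyperplane_root, he]; simp
  obtain ⟨x, hx, hs, hc⟩ := exists_isShort_sameCell hanti hS
  refine ⟨x, hx, hs, ?_⟩
  have hvr : v ∈ region m x := fun i j hij k hk =>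
    ⟨(hc i j hij k hk).1, fun h => lt_of_le_of_ne
      (not_lt.1 fun h' => lt_asymm h ((hc i j hij k hk).2 h')) (hS i j hij k hk)⟩
  rw [← hx.connectedComponentIn_point hm] at hvr ⊢
  exact (connectedComponentIn_eq hvr).symm

/-- A dominant region contains the alcove of only one short window, up to translation. -/
lemma exists_eq_add_const_of_region_eq (hx : IsWindow x) (hy : IsWindow y) (hsx : IsShort m x)
    (hsy : IsShort m y) (h : region m x = region m y) : ∃ c, ∀ i, x i = y i + c :=
  exists_eq_add_const_of_sameCell hx hy hsx hsy
    (hx.sameCell_of_mem_region (point_mem_region x))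
    (hy.sameCell_of_mem_region (h ▸ point_mem_region x))

/-- Points satisfying the weak inequalities are limits of points on segments towards
`point x`. -/
lemma mem_closure_region {v : V n} (h : ∀ i j, i < j → ∀ k : ℕ, k ≤ m →
    ((k * n : ℤ) < x i - x j → (k : ℝ) ≤ v.1 i - v.1 j) ∧
    (x i - x j < k * n → v.1 i - v.1 j ≤ k)) : v ∈ closure (region m x) := by
  have ht := (tendsto_one_div_add_atTop_nhds_zero_nat (𝕜 := ℝ))
  have hlim : Filter.Tendsto (fun N : ℕ => v + (1 / ((N : ℝ) + 1)) • (point x - v))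
      Filter.atTop (nhds v) := by
    have := (tendsto_const_nhds (x := v)).add (ht.smul_const (point x - v))
    simpa using this
  refine mem_closure_of_tendsto hlim (Filter.Eventually.of_forall fun N => ?_)
  have h0 : 0 < 1 / ((N : ℝ) + 1) := by positivity
  have h1 : 1 / ((N : ℝ) + 1) ≤ 1 := by
    rw [div_le_one (by positivity)]; linarith [(Nat.cast_nonneg N : (0 : ℝ) ≤ N)]
  generalize 1 / ((N : ℝ) + 1) = t at h0 h1
  intro i j hij k hk
  have hp := point_mem_region (m := m) x i j hij k hk
  have hw := h i j hij k hk
  have e : (v + t • (point x - v)).1 i - (v + t • (point x - v)).1 j =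
      (1 - t) * (v.1 i - v.1 j) + t * ((point x).1 i - (point x).1 j) := by
    simp; ring
  rw [e]
  constructor
  · intro hlt
    nlinarith [hp.1 hlt, hw.1 hlt]
  · intro hlt
    nlinarith [hp.2 hlt, hw.2 hlt]

/-- The affine hyperplane `v i - v j = c`. -/
def levelSubspace (i j : Fin n) (c : ℝ) : AffineSubspace ℝ (V n) where
  carrier := {v | v.1 i - v.1 j = c}
  smul_vsub_vadd_mem' := by
    intro t p q r hp hq hr
    simp only [Set.mem_ofPred_eq, vsub_eq_sub, vadd_eq_add, Submodule.coe_add, Submodule.coe_smul,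
      Submodule.coe_sub, Pi.add_apply, Pi.smul_apply, Pi.sub_apply, smul_eq_mul] at *
    linear_combination t * hp - t * hq + hr

/-- The midpoint `p` of the segment from `point x` to its mirror image in the hyperplane satisfies
all the other inequalities of the region strictly, so a neighbourhood of `p` in the hyperplane lies
in the closure of the region. -/
lemma containsWall_of_eq {i j : Fin n} (hij : i < j)
    (h : x i - x j = m * n + 1) : ContainsWall (hyperplane (root i j) m) (region m x) := by
  have hn : (0 : ℝ) < n := by exact_mod_cast NeZero.pos n
  apply subset_antisymm
  · have : affineSpan ℝ (closure (region m x) ∩ hyperplane (root i j) m) ≤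
        levelSubspace i j m := affineSpan_le.2 fun v hv => mem_hyperplane_root.1 hv.2
    exact fun v hv => mem_hyperplane_root.2 (this hv)
  · intro w hw
    rw [mem_hyperplane_root, Int.cast_natCast] at hw
    set δ : Fin n → ℝ := fun a => (if a = j then 1 / 2 else 0) - (if a = i then 1 / 2 else 0)
      with hδ
    set p : V n := center fun a => (x a + δ a) / n with hp
    have hpsub : ∀ a b, p.1 a - p.1 b = ((x a - x b : ℤ) + (δ a - δ b)) / n := by
      intro a b; rw [hp, center_sub]; push_cast; ring
    have hpij : p.1 i - p.1 j = m := by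
      rw [hpsub, h, div_eq_iff hn.ne']
      simp [hδ, hij.ne, hij.ne']; ring
    have hδab : ∀ a b, a < b → ¬ (a = i ∧ b = j) → |δ a - δ b| ≤ 1 / 2 := by
      intro a b hab hne
      rw [abs_le]
      simp only [hδ]
      split_ifs <;> first | (constructor <;> linarith) | (exfalso; subst_vars; first
        | exact hne ⟨rfl, rfl⟩ | exact lt_asymm hij hab)
    set D : ℝ := ∑ a, |w.1 a - p.1 a| with hD
    have hD0 : 0 ≤ D := Finset.sum_nonneg fun _ _ => abs_nonneg _
    have hDa : ∀ a, |w.1 a - p.1 a| ≤ D := fun a =>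
      Finset.single_le_sum (f := fun a => |w.1 a - p.1 a|) (fun _ _ => abs_nonneg _)
        (Finset.mem_univ a)
    set ε : ℝ := 1 / (4 * n * (D + 1)) with hε
    have hε0 : 0 < ε := by positivity
    have hεD : ε * (2 * D) ≤ 1 / 2 / n := by
      rw [hε, div_mul_eq_mul_div, div_div, div_le_div_iff₀ (by positivity) (by positivity)]
      nlinarith
    -- The segment from `p` towards `w` stays in the closure up to `ε`, and so its endpoint there and
    -- `p` span `w`.
    have hmem : ∀ t : ℝ, 0 ≤ t → t ≤ ε →
        p + t • (w - p) ∈ closure (region m x) ∩ hyperplane (root i j) m := by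
      intro t ht0 htε
      have e : ∀ a b, (p + t • (w - p)).1 a - (p + t • (w - p)).1 b =
          (p.1 a - p.1 b) + t * ((w.1 a - p.1 a) - (w.1 b - p.1 b)) := by
        intro a b; simp; ring
      have eij : (p + t • (w - p)).1 i - (p + t • (w - p)).1 j = m := by
        rw [e]; linear_combination (1 - t) * hpij + t * hw
      refine ⟨mem_closure_region fun a b hab k hk => ?_, ?_⟩
      · by_cases hne : a = i ∧ b = j
        · obtain ⟨rfl, rfl⟩ := hne
          rw [eij]
          have : (k * n : ℤ) ≤ m * n := by gcongr
          exact ⟨fun _ => by exact_mod_cast hk, fun h' => by linarith⟩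
        · rw [e, hpsub]
          have h1 : |t * ((w.1 a - p.1 a) - (w.1 b - p.1 b))| ≤ 1 / 2 / n := by
            refine le_trans ?_ hεD
            rw [abs_mul, abs_of_nonneg ht0]
            have := abs_sub (w.1 a - p.1 a) (w.1 b - p.1 b)
            have := hDa a
            have := hDa b
            gcongr
            linarith
          have h2 := hδab a b hab hne
          rw [abs_le] at h1 h2
          have h3 : t * ((w.1 a - p.1 a) - (w.1 b - p.1 b)) =
            (t * ((w.1 a - p.1 a) - (w.1 b - p.1 b)) * n) / n := by field_simp
          have h4 : (t * ((w.1 a - p.1 a) - (w.1 b - p.1 b)) * n) ≤ 1 / 2 := by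
            have := h1.2; rwa [le_div_iff₀ hn] at this
          have h5 : -(1 / 2) ≤ (t * ((w.1 a - p.1 a) - (w.1 b - p.1 b)) * n) := by
            have := h1.1; rwa [← neg_div, div_le_iff₀ hn] at this
          rw [h3, ← add_div, le_div_iff₀ hn, div_le_iff₀ hn]
          constructor
          · intro h6
            have : ((k * n + 1 : ℤ) : ℝ) ≤ ((x a - x b : ℤ) : ℝ) := by exact_mod_cast h6
            push_cast at this ⊢
            linarith
          · intro h6
            have : ((x a - x b + 1 : ℤ) : ℝ) ≤ ((k * n : ℤ) : ℝ) := by exact_mod_cast h6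
            push_cast at this ⊢
            linarith
      · rw [mem_hyperplane_root, eij]; simp
    have hq := subset_affineSpan ℝ _ (hmem ε hε0.le le_rfl)
    have hp0 := subset_affineSpan ℝ _ (hmem 0 le_rfl hε0.le)
    have := AffineSubspace.smul_vsub_vadd_mem _ ε⁻¹ hq hp0 hp0
    convert this using 1
    simp [smul_smul, hε0.ne']

/-- Otherwise some `x l` lies between with `v i - v l ≥ a`, `v l - v j ≥ b` on the region and
`a + b ≥ m`; where the closure of the region meets the hyperplane, `v i - v l` is then constant. -/
lemma eq_of_containsWall (hx : IsWindow x) (hs : IsShort m x) {i j : Fin n} (hij : i < j)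
    (h : (m * n : ℤ) < x i - x j)
    (hw : ContainsWall (hyperplane (root i j) m) (region m x)) : x i - x j = m * n + 1 := by
  have hn : (0 : ℤ) < n := by exact_mod_cast NeZero.pos n
  by_contra hne
  obtain ⟨l, hil, hlj, hsum⟩ := hs.exists_between hx hij h.le hne
  obtain ⟨a, ha⟩ := Int.eq_ofNat_of_zero_le
    (Int.ediv_nonneg (sub_pos.2 (hx.anti hil)).le hn.le)
  obtain ⟨b, hb⟩ := Int.eq_ofNat_of_zero_le
    (Int.ediv_nonneg (sub_pos.2 (hx.anti hlj)).le hn.le)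
  have ha' := hx.mul_lt hil.ne
  have hb' := hx.mul_lt hlj.ne
  have hm : (m : ℤ) ≤ (x i - x j) / n := (Int.le_ediv_iff_mul_le hn).2 h.le
  rw [← hsum, ha, hb] at hm
  rw [ha] at ha'
  rw [hb] at hb'
  have hmab : m ≤ min a m + min b m := by omega
  have hsub : affineSpan ℝ (closure (region m x) ∩ hyperplane (root i j) m) ≤
      levelSubspace i l (min a m : ℕ) := affineSpan_le.2 fun v hv => by
    have h1 := mem_hyperplane_root.1 hv.2
    have h2 := le_of_mem_closure_region hv.1 hil (min_le_right a m) (lt_of_le_of_lt (by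
      rw [mul_comm]
      have : ((min a m : ℕ) : ℤ) ≤ a := by exact_mod_cast min_le_left a m
      gcongr) ha')
    have h3 := le_of_mem_closure_region hv.1 hlj (min_le_right b m) (lt_of_le_of_lt (by
      rw [mul_comm]
      have : ((min b m : ℕ) : ℤ) ≤ b := by exact_mod_cast min_le_left b m
      gcongr) hb')
    have h4 : (m : ℝ) ≤ (min a m : ℕ) + (min b m : ℕ) := by exact_mod_cast hmab
    rw [Int.cast_natCast] at h1
    change v.1 i - v.1 l = (min a m : ℕ)
    linarith
  set z : V n := center fun c => (if c = j then -(m : ℝ) else 0) +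
    (if c = l then -(((min a m : ℕ) : ℝ) + 1) else 0) with hz
  have hz1 : z ∈ hyperplane (root i j) m := by
    rw [mem_hyperplane_root, hz, center_sub]
    simp [hij.ne, hil.ne, hlj.ne']
  rw [← hw] at hz1
  have hz2 : z.1 i - z.1 l = (min a m : ℕ) := hsub hz1
  rw [hz, center_sub] at hz2
  simp [hij.ne, hil.ne, hlj.ne] at hz2

lemma exists_mem_fundamentalAlcove :
    ∃ v ∈ fundamentalAlcove n, ∀ i j : Fin n, v.1 i - v.1 j < 1 := by
  have hn : (0 : ℝ) < n := by exact_mod_cast NeZero.pos n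
  have key : ∀ i j : Fin n, (center fun i : Fin n => -((i : ℕ) : ℝ) / n).1 i -
      (center fun i : Fin n => -((i : ℕ) : ℝ) / n).1 j < 1 := by
    intro i j
    rw [center_sub, ← sub_div, div_lt_one hn]
    have : ((j : ℕ) : ℝ) < n := by exact_mod_cast j.2
    have : (0 : ℝ) ≤ (i : ℕ) := by positivity
    linarith
  refine ⟨_, ⟨?_, ?_⟩, key⟩
  · rintro _ ⟨i, j, hij, rfl⟩
    rw [pairing_root, center_sub, ← sub_div, ← hij]
    push_cast
    apply div_pos _ hn
    linarith
  · rw [highestRoot, pairing_root]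
    exact key _ _

lemma sub_lt_one_of_mem_fundamentalAlcove {v : V n} (hv : v ∈ fundamentalAlcove n) (i j : Fin n) :
    v.1 i - v.1 j < 1 := by
  have hanti : StrictAnti v.1 := strictAnti_of_simple fun a b hab => by
    have := hv.1 _ ⟨a, b, hab, rfl⟩
    rw [pairing_root] at this
    exact sub_pos.1 this
  have h := hv.2
  rw [highestRoot, pairing_root] at h
  have h1 := hanti.antitone (Fin.zero_le i)
  have h2 := hanti.antitone (show j ≤ Fin.rev 0 from Fin.le_def.2 (by
    have := j.2
    simp only [Fin.val_rev, Fin.val_zero]; omega))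
  linarith

lemma separates_iff (hm : 1 ≤ m) {i j : Fin n} (hij : i < j) :
    Separates (root i j) m (region m x) (fundamentalAlcove n) ↔ (m * n : ℤ) < x i - x j := by
  have hm' : (1 : ℝ) ≤ m := by exact_mod_cast hm
  constructor
  · rintro (⟨h, -⟩ | ⟨-, h⟩)
    · have := h _ (point_mem_region x)
      rwa [pairing_root, point_sub, Int.cast_natCast, natCast_lt_div] at this
    · obtain ⟨v, hv, hv1⟩ := exists_mem_fundamentalAlcove (n := n)
      have h1 := h v hv
      have h2 := hv1 i j
      rw [pairing_root, Int.cast_natCast] at h1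
      linarith
  · intro h
    refine Or.inl ⟨fun v hv => ?_, fun v hv => ?_⟩
    · rw [pairing_root, Int.cast_natCast]
      exact (hv i j hij m le_rfl).1 h
    · rw [pairing_root, Int.cast_natCast]
      exact (sub_lt_one_of_mem_fundamentalAlcove hv i j).trans_le hm'

lemma hyperplane_root_inj (hm : 1 ≤ m) {i j i' j' : Fin n} (hij : i ≠ j)
    (h : hyperplane (root i j) m = hyperplane (root i' j') m) : i = i' ∧ j = j' := by
  have hm' : (1 : ℝ) ≤ m := by exact_mod_cast hm
  set z : V n := center fun c => (if c = i then (m : ℝ) / 2 else 0) -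
    (if c = j then (m : ℝ) / 2 else 0) with hz
  have hz1 : z ∈ hyperplane (root i j) m := by
    rw [mem_hyperplane_root, hz, center_sub]
    simp [hij, hij.symm]
  rw [h, mem_hyperplane_root, hz, center_sub, Int.cast_natCast] at hz1
  constructor
  · by_contra hne
    rw [if_neg (Ne.symm hne)] at hz1
    split_ifs at hz1 <;> linarith
  · by_contra hne
    rw [if_neg (Ne.symm hne)] at hz1
    split_ifs at hz1 <;> linarith

/-- For a short window, the walls `H_{α,m}` separating the region from `A_0` are the walls of level
`m` of its alcove. -/
lemma ncard_separatingWalls (hm : 1 ≤ m) (hx : IsWindow x) (hs : IsShort m x) :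
    (separatingWalls n m (region m x)).ncard =
      {q : Fin n × Fin n | x q.1 - x q.2 = m * n + 1}.ncard := by
  have hlt : ∀ i j, x i - x j = m * n + 1 → i < j := fun i j h => hx.anti.lt_iff_gt.1 (by
    have : (0 : ℤ) ≤ m * n := by positivity
    linarith)
  have himg : separatingWalls n m (region m x) = (fun q : Fin n × Fin n =>
      hyperplane (root q.1 q.2) m) '' {q | x q.1 - x q.2 = m * n + 1} := by
    ext H
    constructor
    · rintro ⟨_, ⟨i, j, hij, rfl⟩, rfl, hsep, hw⟩
      exact ⟨(i, j), eq_of_containsWall hx hs hij ((separates_iff hm hij).1 hsep) hw, rfl⟩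
    · rintro ⟨⟨i, j⟩, h, rfl⟩
      have hij := hlt i j h
      refine ⟨_, ⟨i, j, hij, rfl⟩, rfl, (separates_iff hm hij).2 ?_, containsWall_of_eq hij h⟩
      have h' : x i - x j = m * n + 1 := h
      omega
  rw [himg, Set.InjOn.ncard_image]
  rintro ⟨i, j⟩ h ⟨i', j'⟩ - he
  obtain ⟨rfl, rfl⟩ := hyperplane_root_inj hm (hlt i j h).ne he
  rfl

end Region
end Geometry

/-! ### Cores, windows and regions -/

section Correspondence

variable {n m k : ℕ} {μ : YoungDiagram} {x : Fin n → ℤ}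

/-- The integers lying at or below the entry of `x` in their residue class modulo `n`. -/
def windowSet (x : Fin n → ℤ) : Set ℤ := {p | ∃ i, p ≤ x i ∧ (p : ZMod n) = x i}

lemma IsWindow.mem_windowSet_iff (hx : IsWindow x) {p : ℤ} {i : Fin n}
    (h : (p : ZMod n) = x i) : p ∈ windowSet x ↔ p ≤ x i := by
  constructor
  · rintro ⟨j, hle, hj⟩
    rwa [hx.inj (h.symm.trans hj)]
  · exact fun hle => ⟨i, hle, h⟩

lemma IsWindow.eq_of_windowSet_eq {y : Fin n → ℤ} (hx : IsWindow x) (hy : IsWindow y)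
    (h : windowSet x = windowSet y) : x = y := by
  have aux : ∀ {a b : Fin n → ℤ}, windowSet a = windowSet b → ∀ i, ∃ j, a i ≤ b j ∧
      (a i : ZMod n) = b j := fun {a b} hab i => by
    have : a i ∈ windowSet a := ⟨i, le_rfl, rfl⟩
    rwa [hab] at this
  have hsub : ∀ {a b : Fin n → ℤ}, IsWindow a → windowSet a = windowSet b →
      Set.range a ⊆ Set.range b := by
    rintro a b ha hab _ ⟨i, rfl⟩
    obtain ⟨j, hle, hj⟩ := aux hab i
    obtain ⟨l, hle', hl⟩ := aux hab.symm j
    obtain rfl : i = l := ha.inj (hj.trans hl)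
    exact ⟨j, le_antisymm hle' hle⟩
  exact (StrictAnti.range_inj hx.anti hy.anti).1 ((hsub hx h).antisymm (hsub hy h.symm))

lemma mem_windowSet_iff_of_eq_add {y : Fin n → ℤ} {c p : ℤ} (h : ∀ i, x i = y i + c) :
    p ∈ windowSet x ↔ p - c ∈ windowSet y := by
  refine exists_congr fun i => and_congr (by rw [h, sub_le_iff_le_add]) ?_
  rw [h, Int.cast_add, Int.cast_sub, sub_eq_iff_eq_add]

lemma sub_mem_windowSet {p : ℤ} (hp : p ∈ windowSet x) : p - n ∈ windowSet x := by
  obtain ⟨i, hle, hi⟩ := hp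
  exact ⟨i, by omega, by simpa using hi⟩

lemma IsWindow.isShort_iff [NeZero n] (hx : IsWindow x) :
    IsShort m x ↔ ∀ p ∈ windowSet x, p - (m * n + 1 : ℕ) ∈ windowSet x := by
  constructor
  · rintro h p ⟨i, hle, hi⟩
    obtain ⟨j, hj⟩ := hx.exists_residue ((x i : ZMod n) - 1)
    have := h i j (by rw [hj]; ring)
    refine ⟨j, by push_cast; linarith, ?_⟩
    rw [hj, ← hi]; simp
  · intro h i j hij
    have := h (x i) ⟨i, le_rfl, rfl⟩
    rw [hx.mem_windowSet_iff (i := j) (by simp [hij])] at this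
    push_cast at this; linarith

/-- The bead set of an `n`-core is determined by its largest bead in each residue class. -/
lemma IsCore.exists_isWindow [NeZero n] (h : IsCore n μ) :
    ∃ x : Fin n → ℤ, IsWindow x ∧ beads μ = windowSet x := by
  have hn : (0 : ℤ) < n := by exact_mod_cast NeZero.pos n
  have hcl := (isCore_iff (NeZero.pos n)).1 h
  have hmul : ∀ p ∈ beads μ, ∀ t : ℕ, p - n * t ∈ beads μ := by
    intro p hp t
    induction t with
    | zero => simpa using hp
    | succ t ih => have := hcl _ ih; push_cast; rwa [mul_add, mul_one, ← sub_sub]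
  have hmax : ∀ z : ZMod n, ∃ a : ℤ, (a ∈ beads μ ∧ (a : ZMod n) = z) ∧
      ∀ p : ℤ, p ∈ beads μ ∧ (p : ZMod n) = z → p ≤ a := by
    intro z
    refine Int.exists_greatest_of_bdd (P := fun p => p ∈ beads μ ∧ (p : ZMod n) = z)
      ⟨bead μ 0, ?_⟩ ?_
    · rintro _ ⟨⟨i, rfl⟩, -⟩
      exact (bead_strictAnti μ).antitone (Nat.zero_le i)
    · have hlow : ∀ p : ℤ, p < -(μ.colLen 0 : ℤ) → p ∈ beads μ := by
        intro p hp
        by_contra hg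
        obtain ⟨j, hj⟩ := notMem_beads_iff.1 hg
        have := μ.colLen_anti 0 j (Nat.zero_le j)
        simp only [gap] at hj
        omega
      refine ⟨z.val - n * (z.val + μ.colLen 0 + 1), hlow _ ?_, by simp⟩
      nlinarith [(Nat.cast_nonneg z.val : (0 : ℤ) ≤ z.val)]
  choose a ha hmax using hmax
  obtain e := Fintype.equivFinOfCardEq (ZMod.card n)
  have hinj : Function.Injective fun i => a (e.symm i) := fun i j hij => by
    have := congrArg (Int.cast : ℤ → ZMod n) hij
    simp only [(ha _).2] at this
    exact e.symm.injective this
  set σ := Tuple.sort fun i => -a (e.symm i) with hσ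
  have hmono : Monotone fun i => -a (e.symm (σ i)) := Tuple.monotone_sort fun i => -a (e.symm i)
  refine ⟨fun i => a (e.symm (σ i)), ⟨?_, ?_⟩, ?_⟩
  · intro i j hij
    refine lt_of_le_of_ne (neg_le_neg_iff.1 (hmono hij.le)) fun he => hij.ne' ?_
    exact σ.injective (hinj he)
  · intro i j hij
    simp only [(ha _).2] at hij
    exact σ.injective (e.symm.injective hij)
  · ext p
    constructor
    · intro hp
      refine ⟨σ.symm (e p), ?_⟩
      simp only [Equiv.apply_symm_apply, Equiv.symm_apply_apply, (ha _).2, and_true]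
      exact hmax _ _ ⟨hp, rfl⟩
    · rintro ⟨i, hle, hi⟩
      obtain ⟨t, ht⟩ := (ZMod.intCast_eq_intCast_iff_dvd_sub _ _ _).1 hi
      obtain ⟨t, rfl⟩ := Int.eq_ofNat_of_zero_le (show 0 ≤ t by
        by_contra! hneg
        nlinarith)
      have := hmul _ (ha (e.symm (σ i))).1 t
      rwa [show p = a (e.symm (σ i)) - n * t by linarith]

lemma IsWindow.exists_youngDiagram [NeZero n] (hx : IsWindow x) :
    ∃ (μ : YoungDiagram) (c : ℤ), beads μ = windowSet fun i => x i - c := by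
  obtain ⟨M, hM⟩ := (Set.finite_range x).bddAbove
  obtain ⟨N, hN⟩ := (Set.finite_range x).bddBelow
  obtain ⟨μ, c, h⟩ := exists_beads (B := windowSet x) (M := M) (N := N)
    (fun p ⟨i, hle, _⟩ => hle.trans (hM ⟨i, rfl⟩))
    (fun p hp => by
      obtain ⟨i, hi⟩ := hx.exists_residue p
      exact ⟨i, hp.trans (hN ⟨i, rfl⟩), hi.symm⟩)
  refine ⟨μ, c, Set.ext fun p => ?_⟩
  rw [h, mem_windowSet_iff_of_eq_add (y := fun i => x i - c) (c := c) (by simp), add_sub_cancel_right]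

/-- If `x i - x j = t * n + 1`, the beads of the class of `x i` with an empty place to their left
are the topmost `t` ones (none if `t` is negative). -/
lemma numRemovable_eq_iff [NeZero n] (hm : 1 ≤ m) (hx : IsWindow x)
    (hμ : beads μ = windowSet x) {i j : Fin n} (hij : (x i : ZMod n) = x j + 1) :
    numRemovable n μ (x i) = m ↔ x i - x j = m * n + 1 := by
  have hn : (0 : ℤ) < n := by exact_mod_cast NeZero.pos n
  obtain ⟨t, ht⟩ : (n : ℤ) ∣ x i - x j - 1 := by
    rw [← ZMod.intCast_zmod_eq_zero_iff_dvd]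
    push_cast; rw [hij]; ring
  have himg : {p : ℤ | p ∈ beads μ ∧ p - 1 ∉ beads μ ∧ (p : ZMod n) = x i} =
      (fun s : ℕ => x i - n * s) '' (Finset.range t.toNat : Finset ℕ) := by
    ext p
    simp only [Set.mem_ofPred_eq, Set.mem_image, Finset.coe_range, Set.mem_Iio, hμ]
    constructor
    · rintro ⟨hp, hp1, hpi⟩
      rw [hx.mem_windowSet_iff hpi] at hp
      rw [hx.mem_windowSet_iff (i := j) (by push_cast; rw [hpi, hij]; ring), not_le] at hp1
      obtain ⟨s, hs⟩ := (ZMod.intCast_eq_intCast_iff_dvd_sub _ _ _).1 hpi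
      have hs0 : 0 ≤ s := by by_contra! hneg; nlinarith
      have hst : s < t := by by_contra! hneg; nlinarith
      obtain ⟨s, rfl⟩ := Int.eq_ofNat_of_zero_le hs0
      exact ⟨s, by omega, by linarith⟩
    · rintro ⟨s, hst, rfl⟩
      have hpi : ((x i - n * s : ℤ) : ZMod n) = x i := by simp
      rw [hx.mem_windowSet_iff hpi, hx.mem_windowSet_iff (i := j) (by push_cast; rw [hij]; simp)]
      have h1 : (s : ℤ) + 1 ≤ t := by omega
      refine ⟨?_, ?_, hpi⟩
      · have : (0 : ℤ) ≤ n * s := by positivity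
        linarith
      · nlinarith
  -- `m ≥ 1` makes the truncation `t.toNat` harmless: `t.toNat = m` forces `t = m`.
  rw [numRemovable_eq, himg, Set.InjOn.ncard_image, Set.ncard_coe_finset, Finset.card_range]
  · constructor
    · intro h
      have : t = m := by omega
      rw [this] at ht; linarith
    · intro h
      have : (n : ℤ) * t = n * m := by linarith
      have := mul_left_cancel₀ hn.ne' this
      omega
  · intro s _ s' _ h
    have : (n : ℤ) * s = n * s' := by simpa using h
    exact_mod_cast mul_left_cancel₀ hn.ne' this

lemma ncard_numRemovable_eq [NeZero n] (hm : 1 ≤ m) (hx : IsWindow x)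
    (hμ : beads μ = windowSet x) : {r : ZMod n | numRemovable n μ r = m}.ncard =
      {q : Fin n × Fin n | x q.1 - x q.2 = m * n + 1}.ncard := by
  have hres : ∀ i j, x i - x j = m * n + 1 → (x i : ZMod n) = x j + 1 := by
    intro i j h
    rw [show x i = x j + (m * n + 1) by linarith]; push_cast; simp
  have himg : {r : ZMod n | numRemovable n μ r = m} = (fun q : Fin n × Fin n => (x q.1 : ZMod n)) ''
      {q | x q.1 - x q.2 = m * n + 1} := by
    ext r
    constructor
    · intro hr
      obtain ⟨i, rfl⟩ := hx.exists_residue r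
      obtain ⟨j, hj⟩ := hx.exists_residue ((x i : ZMod n) - 1)
      exact ⟨(i, j), (numRemovable_eq_iff hm hx hμ (by rw [hj]; ring)).1 hr, rfl⟩
    · rintro ⟨⟨i, j⟩, h, rfl⟩
      exact (numRemovable_eq_iff hm hx hμ (hres i j h)).2 h
  rw [himg, Set.InjOn.ncard_image]
  rintro ⟨i, j⟩ h ⟨i', j'⟩ h' he
  obtain rfl : i = i' := hx.inj he
  have h1 : x i - x j = m * n + 1 := h
  have h2 : x i - x j' = m * n + 1 := h'
  have : x j = x j' := by linarith
  rw [hx.anti.injective this]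

lemma mem_narayanaCores_iff [NeZero n] : μ ∈ narayanaCores n m k ↔
    IsCore n μ ∧ IsCore (m * n + 1) μ ∧ {r : ZMod n | numRemovable n μ r = m}.ncard = k := by
  refine and_congr_right fun _ => and_congr_right fun _ => ?_
  constructor
  · rintro ⟨K, rfl, hK⟩
    rw [← Set.ncard_coe_finset]
    congr 1
    ext r
    simpa using hK r
  · rintro rfl
    have hfin : {r : ZMod n | numRemovable n μ r = m}.Finite := Set.toFinite _
    exact ⟨hfin.toFinset, (Set.ncard_eq_toFinset_card _ hfin).symm, fun r => by simp⟩

lemma finite_isDominantRegion [NeZero n] (hm : 1 ≤ m) :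
    {R : Set (V n) | IsDominantRegion n m R}.Finite := by
  refine (Set.finite_range fun s : Fin n → Fin n → Fin (m + 1) → Prop × Prop =>
    {v : V n | ∀ i j, i < j → ∀ k : ℕ, ∀ hk : k ≤ m,
      ((s i j ⟨k, Nat.lt_succ_of_le hk⟩).1 → (k : ℝ) < v.1 i - v.1 j) ∧
      ((s i j ⟨k, Nat.lt_succ_of_le hk⟩).2 → v.1 i - v.1 j < k)}).subset ?_
  intro R hR
  obtain ⟨x, -, -, rfl⟩ := IsDominantRegion.exists_isShort hm hR
  exact ⟨fun i j k => ((k * n : ℤ) < x i - x j, x i - x j < k * n), rfl⟩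

/-- An `n`-core that is an `(m * n + 1)`-core goes to the region of its window. This is a bijection
onto the dominant regions, and both statistics count the pairs with `x i - x j = m * n + 1`. -/
lemma exists_bijOn [NeZero n] (hm : 1 ≤ m) : ∃ F : YoungDiagram → Set (V n),
    ∀ k, Set.BijOn F (narayanaCores n m k) (narayanaRegions n m k) := by
  have hex : ∀ μ : YoungDiagram, ∃ x : Fin n → ℤ, IsCore n μ → IsCore (m * n + 1) μ →
      IsWindow x ∧ IsShort m x ∧ beads μ = windowSet x := by
    intro μ
    by_cases h : IsCore n μ ∧ IsCore (m * n + 1) μ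
    · obtain ⟨x, hx, hμ⟩ := h.1.exists_isWindow
      refine ⟨x, fun _ _ => ⟨hx, hx.isShort_iff.2 ?_, hμ⟩⟩
      rw [← hμ]
      exact (isCore_iff (Nat.succ_pos _)).1 h.2
    · exact ⟨0, fun h1 h2 => absurd ⟨h1, h2⟩ h⟩
  choose X hX using hex
  refine ⟨fun μ => region m (X μ), fun k => ⟨?_, ?_, ?_⟩⟩
  · intro μ hμ
    obtain ⟨h1, h2, h3⟩ := mem_narayanaCores_iff.1 hμ
    obtain ⟨hx, hs, hb⟩ := hX μ h1 h2
    exact ⟨hx.isDominantRegion hm,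
      by rw [ncard_separatingWalls hm hx hs, ← ncard_numRemovable_eq hm hx hb, h3]⟩
  · rintro μ ⟨h1, h2, -⟩ ν ⟨h1', h2', -⟩ he
    obtain ⟨hx, hs, hb⟩ := hX μ h1 h2
    obtain ⟨hx', hs', hb'⟩ := hX ν h1' h2'
    obtain ⟨c, hc⟩ := exists_eq_add_const_of_region_eq hx hx' hs hs' he
    refine eq_of_beads (c := -c) fun p => ?_
    rw [hb, hb', mem_windowSet_iff_of_eq_add hc]
    simp [sub_eq_add_neg]
  · rintro R ⟨hR, hk⟩
    obtain ⟨x, hx, hs, rfl⟩ := hR.exists_isShort hm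
    obtain ⟨μ, c, hb⟩ := hx.exists_youngDiagram
    set y : Fin n → ℤ := fun i => x i - c with hy
    have hxy : ∀ i, x i = y i + c := fun i => by simp [hy]
    have hyw : IsWindow y := ⟨fun i j hij => by simpa [hy] using hx.anti hij,
      fun i j hij => hx.inj (by simpa [hy] using hij)⟩
    have hys : IsShort m y := fun i j hij => by
      have := hs i j (by rw [hxy i, hxy j]; push_cast; rw [hij]; ring)
      simpa [hy] using this
    have h1 : IsCore n μ := (isCore_iff (NeZero.pos n)).2 (by
      rw [hb]; exact fun p hp => sub_mem_windowSet hp)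
    have h2 : IsCore (m * n + 1) μ := (isCore_iff (Nat.succ_pos _)).2 (by
      rw [hb]; exact hyw.isShort_iff.1 hys)
    rw [region_add_const hxy] at hk ⊢
    obtain ⟨hx', hs', hb'⟩ := hX μ h1 h2
    have hXy : X μ = y := hx'.eq_of_windowSet_eq hyw (hb'.symm.trans hb)
    refine ⟨μ, mem_narayanaCores_iff.2 ⟨h1, h2, ?_⟩, by simp only [hXy]⟩
    rw [ncard_numRemovable_eq hm hyw hb, ← ncard_separatingWalls hm hyw hys, hk]

end Correspondence

end ShiCore

theorem corollary8p3 (n m k : ℕ) [NeZero n] (hm : 1 ≤ m) :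
    (ShiCore.narayanaRegions n m k).Finite ∧ (ShiCore.narayanaCores n m k).Finite ∧
      ShiCore.narayana n m k = (ShiCore.narayanaCores n m k).ncard := by
  obtain ⟨F, hF⟩ := ShiCore.exists_bijOn (n := n) hm
  have hfin : (ShiCore.narayanaRegions n m k).Finite :=
    (ShiCore.finite_isDominantRegion hm).subset fun R hR => hR.1
  refine ⟨hfin, (hF k).finite_iff_finite.2 hfin, ?_⟩
  rw [ShiCore.narayana, ← (hF k).image_eq, (hF k).injOn.ncard_image]
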